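/- Let $n,p\ge 0$ be integers, $X\in\mathbb R^{n\times p}$ a matrix with rows $x_1^\intercal,\dots,x_n^\intercal$, $y\in\{0,1\}^n$ and $\zeta>0$. Let $\pi_{\rm loc}$ be a probability density on $(0,\infty)$, and let the prior $\pi_{\rm glo}$ be a probability measure supported on $[\tau_{\min},\tau_{\max}]$ with $0<\tau_{\min}\le\tau_{\max}<\infty$. Consider the Pólya-Gamma Gibbs sampler for the regularized sparse logistic regression model $$y_i\mid\beta\sim\mathrm{Bernoulli}\big(1/(1+e^{-x_i^\intercal\beta})\big),\quad z_j=0\mid\beta_j\sim\mathcal N(\beta_j,\zeta^2),\quad \beta_j\mid\tau,\lambda_j\sim\mathcal N(0,\tau^2\lambda_j^2),\quad \lambda_j\sim\pi_{\rm loc},\quad \tau\sim\pi_{\rm glo},$$ which, from the current state $(\beta^*,\lambda^*)$, draws successively: 1. $\tau\mid\beta^*,\lambda^*$ from the probability law $\pi(d\tau\mid\beta^*,\lambda^*)\propto \prod_{j}\tau^{-1}\exp\!\big(-\beta_j^{*2}/(2\tau^2\lambda_j^{*2})\big)\,\pi_{\rm glo}(d\tau)$; 2. $\lambda_j\mid\beta_j^*,\tau$,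 independently for $j=1,\dots,p$, from the density $\pi(\lambda_j\mid\beta^*_j,\tau)\propto \lambda_j^{-1}\exp\!\big(-\beta_j^{*2}/(2\tau^2\lambda_j^2)\big)\pi_{\rm loc}(\lambda_j)$ on $(0,\infty)$; 3. $\omega_i\mid\beta^*\sim\mathrm{PolyaGamma}(1,x_i^\intercal\beta^*)$, independently for $i=1,\dots,n$, where $\mathrm{PolyaGamma}(1,c)$ is the law of $\frac1{2\pi^2}\sum_{k\ge1}\frac{g_k}{(k-1/2)^2+c^2/(4\pi^2)}$ with $g_k$ i.i.d. exponential of rate $1$; 4. $\beta\mid\omega,\tau,\lambda\sim\mathcal N\big(\Phi^{-1}X^\intercal(y-\tfrac12),\Phi^{-1}\big)$, where $\Phi=X^\intercal\mathrm{diag}(\omega)X+\zeta^{-2}I+\tau^{-2}\mathrm{diag}(\lambda)^{-2}$. Its marginal transition kernel in $(\beta,\lambda)$ has the density $$P(\beta,\lambda\mid\beta^*,\lambda^*)=\int P(\beta\mid\beta^*,\tau,\lambda)\,\prod_j\pi(\lambda_j\mid\beta_j^*,\tau)\;\pi(d\tau\mid\beta^*,\lambda^*),\qquad P(\beta\mid\beta^*,\tau,\lambda)=\int\pi(\beta\mid\omega,\tau,\lambda)\,\pi(d\omega\mid\beta^*),$$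 where $\pi(\beta\mid\omega,\tau,\lambda)$ is the Gaussian density of step 4 and $\pi(d\omega\mid\beta^*)$ is the law in step 3. Then for all $0<\epsilon\le E<\infty$ this kernel satisfies a minorization condition on the small set $$S=\big\{(\beta^*,\lambda^*)\in\mathbb R^p\times(0,\infty)^p:\ \epsilon\le|\beta_j^*|\le E\text{ for all }j\big\}:$$ there are $\delta>0$ and a probability density $q$ on $\mathbb R^p\times(0,\infty)^p$ such that $$P(\beta,\lambda\mid\beta^*,\lambda^*)\ \ge\ \delta\,q(\beta,\lambda)\qquad\text{for all }(\beta^*,\lambda^*)\in S\text{ and all }(\beta,\lambda)\in\mathbb R^p\times(0,\infty)^p .$$ -/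

import Mathlib

open MeasureTheory ProbabilityTheory
open scoped ENNReal Matrix

noncomputable section

/-- The function `g ↦ (1 / (2π²)) ∑_{k ≥ 0} g_k / ((k + 1/2)² + c² / (4π²))` of a sequence `g`. The
terms are nonnegative for almost every sequence of exponential variables, and the sum is formed in
`[0, ∞]`. -/
def polyaGammaSeries (c : ℝ) (g : ℕ → ℝ) : ℝ :=
  (∑' k : ℕ, ENNReal.ofReal
    (g k / (2 * Real.pi ^ 2 * (((k : ℝ) + 1 / 2) ^ 2 + c ^ 2 / (4 * Real.pi ^ 2))))).toReal

/-- The Pólya-Gamma distribution with shape `1` and tilting `c`: the law of the series above for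
independent exponential variables `g_k` of rate `1`. -/
def polyaGamma (c : ℝ) : Measure ℝ :=
  (Measure.infinitePi fun _ : ℕ => expMeasure 1).map (polyaGammaSeries c)

/-- Density at `x` of the Gaussian distribution on `ℝᵖ` with mean `m` and covariance `C`. -/
def gaussianDensity {p : ℕ} (m : Fin p → ℝ) (C : Matrix (Fin p) (Fin p) ℝ) (x : Fin p → ℝ) : ℝ :=
  (Real.sqrt ((2 * Real.pi) ^ p * C.det))⁻¹ *
    Real.exp (-(1 / 2) * ((x - m) ⬝ᵥ (C⁻¹ *ᵥ (x - m))))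

/-- The precision `Φ = Xᵀ Ω X + ζ⁻² I + τ⁻² Λ⁻²`, where `Ω = diag ω` and `Λ = diag l`. -/
def posteriorPrecision {n p : ℕ} (X : Matrix (Fin n) (Fin p) ℝ) (ζ : ℝ) (ω : Fin n → ℝ) (τ : ℝ)
    (l : Fin p → ℝ) : Matrix (Fin p) (Fin p) ℝ :=
  Xᵀ * Matrix.diagonal ω * X + (ζ ^ 2)⁻¹ • (1 : Matrix (Fin p) (Fin p) ℝ)
    + (τ ^ 2)⁻¹ • Matrix.diagonal (fun j => (l j ^ 2)⁻¹)

/-- Density at `β` of the Gaussian update `β | ω, τ, l, y, X, z = 0`, which is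
`N(Φ⁻¹ Xᵀ (y - 1/2), Φ⁻¹)`. -/
def regCoefConditionalDensity {n p : ℕ} (X : Matrix (Fin n) (Fin p) ℝ) (y : Fin n → ℝ) (ζ : ℝ)
    (ω : Fin n → ℝ) (τ : ℝ) (l β : Fin p → ℝ) : ℝ :=
  gaussianDensity
    ((posteriorPrecision X ζ ω τ l)⁻¹ *ᵥ (Xᵀ *ᵥ fun i => y i - 1 / 2))
    (posteriorPrecision X ζ ω τ l)⁻¹ β

/-- The law of `ω | β*, X`: independent `ω_i ∼ PolyaGamma(1, x_iᵀ β*)`, where `x_i` is the `i`th row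
of `X`. -/
def polyaGammaConditional {n p : ℕ} (X : Matrix (Fin n) (Fin p) ℝ) (βs : Fin p → ℝ) :
    Measure (Fin n → ℝ) :=
  Measure.pi fun i => polyaGamma ((X *ᵥ βs) i)

/-- `P(β | β*, τ, l) = ∫ π(β | ω, τ, l, y, X, z = 0) π(dω | β*, X)`. -/
def regCoefKernelDensity {n p : ℕ} (X : Matrix (Fin n) (Fin p) ℝ) (y : Fin n → ℝ) (ζ : ℝ)
    (βs : Fin p → ℝ) (τ : ℝ) (l β : Fin p → ℝ) : ℝ≥0∞ :=
  ∫⁻ ω, ENNReal.ofReal (regCoefConditionalDensity X y ζ ω τ l β) ∂(polyaGammaConditional X βs)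

/-- The unnormalized conditional density `(τ l)⁻¹ exp(-b² / (2 τ² l²)) π_loc(l)` of a local scale. -/
def localScaleWeight (πloc : ℝ → ℝ) (b τ l : ℝ) : ℝ≥0∞ :=
  ENNReal.ofReal ((τ * l)⁻¹ * Real.exp (-(b ^ 2) / (2 * τ ^ 2 * l ^ 2)) * πloc l)

/-- The conditional density `π(l_j | β_j = b, τ)` of a local scale, at `l`. -/
def localScaleConditionalDensity (πloc : ℝ → ℝ) (b τ l : ℝ) : ℝ≥0∞ :=
  localScaleWeight πloc b τ l / ∫⁻ t in Set.Ioi 0, localScaleWeight πloc b τ t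

/-- The factor `∏_j τ⁻¹ exp(-β_j² / (2 τ² l_j²))` of the joint conditional density of the scales.
The remaining factors `∏_j l_j⁻¹ π_loc(l_j)` do not depend on `τ`. -/
def globalScaleWeight {p : ℕ} (β l : Fin p → ℝ) (τ : ℝ) : ℝ≥0∞ :=
  ENNReal.ofReal (∏ j, τ⁻¹ * Real.exp (-(β j ^ 2) / (2 * τ ^ 2 * l j ^ 2)))

/-- The law of `τ | β*, l*`: it is proportional to
`∏_j τ⁻¹ exp(-β*_j² / (2 τ² l*_j²)) π_glo(dτ)`. -/
def globalScaleConditional {p : ℕ} (πglo : Measure ℝ) (βs ls : Fin p → ℝ) : Measure ℝ :=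
  (∫⁻ τ, globalScaleWeight βs ls τ ∂πglo)⁻¹ • πglo.withDensity (globalScaleWeight βs ls)

/-- The marginal transition density of the Pólya-Gamma Gibbs sampler in the coefficients and the
local scales, from `s = (β*, l*)` to `t = (β, l)`:
`P(β, l | β*, l*) = ∫ P(β | β*, τ, l) ∏_j π(l_j | β*_j, τ) π(dτ | β*, l*)`. -/
def gibbsKernelDensity {n p : ℕ} (X : Matrix (Fin n) (Fin p) ℝ) (y : Fin n → ℝ) (ζ : ℝ)
    (πloc : ℝ → ℝ) (πglo : Measure ℝ) (s t : (Fin p → ℝ) × (Fin p → ℝ)) : ℝ≥0∞ :=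
  ∫⁻ τ, regCoefKernelDensity X y ζ s.1 τ t.2 t.1 *
      ∏ j, localScaleConditionalDensity πloc (s.1 j) τ (t.2 j)
    ∂(globalScaleConditional πglo s.1 s.2)

/-- A transition density `P` (`P s t` is the density at `t` of the move from `s`), with respect to
the reference measure, satisfies a minorization condition on `S` if `P s t ≥ δ q(t)` for all
`s ∈ S` and all `t`, for some `δ > 0` and some probability density `q`. -/
def SatisfiesMinorization {Θ : Type*} [MeasureSpace Θ] (P : Θ → Θ → ℝ≥0∞) (S : Set Θ) : Prop :=
  ∃ δ : ℝ, 0 < δ ∧ ∃ q : Θ → ℝ≥0∞, Measurable q ∧ ∫⁻ t, q t = 1 ∧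
    ∀ s ∈ S, ∀ t, ENNReal.ofReal δ * q t ≤ P s t

end

noncomputable section

/-! It suffices to bound the transition density below by a function of the target alone with nonzero
integral (`SatisfiesMinorization.of_le`). The start enters in three places. Through `ω`: the
Pólya-Gamma means are bounded uniformly in the tilt, so a fixed box `[0, R]ⁿ` always has mass at
least `2⁻ⁿ`. On it the Gaussian density has an explicit lower bound, since `ζ⁻² I` keeps `Φ` away
from singularity (`regCoefLowerBound_le`). Through the local scales: `ε ≤ |β*_j|` bounds the
normalizing constant by `ε⁻¹`, and `|β*_j| ≤ E` bounds the numerator below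
(`ofReal_localScaleLowerBound_le`). Through `τ`: its law is a probability on `[τmin, τmax]` whatever
`λ*` is, and the other two bounds are uniform there, so averaging over `τ` preserves them. -/

/-! ### Uniform tightness of the Pólya-Gamma laws -/

theorem lintegral_ofReal_expMeasure_one_le :
    ∫⁻ x, ENNReal.ofReal x ∂(expMeasure 1) ≤ 4 := by
  have hdens : expMeasure 1 = volume.withDensity (exponentialPDF 1) := rfl
  have hmeas : Measurable (exponentialPDF 1) := (measurable_exponentialPDFReal 1).ennreal_ofReal
  rw [hdens, lintegral_withDensity_eq_lintegral_mul _ hmeas ENNReal.measurable_ofReal]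
  -- Since `x ≤ 2 exp (x / 2)`, `x exp (-x)` is at most four times the density of rate `1/2`. Any
  -- finite bound on the mean would do.
  have hle : ∀ x : ℝ, (exponentialPDF 1 * fun x => ENNReal.ofReal x) x
      ≤ 4 * exponentialPDF (1 / 2) x := by
    intro x
    rcases lt_or_ge x 0 with hx | hx
    · simp [exponentialPDF_of_neg hx]
    · rw [Pi.mul_apply, exponentialPDF_of_nonneg hx, exponentialPDF_of_nonneg hx,
        ← ENNReal.ofReal_mul (by positivity),
        show (4 : ℝ≥0∞) = ENNReal.ofReal 4 by simp, ← ENNReal.ofReal_mul (by norm_num)]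
      apply ENNReal.ofReal_le_ofReal
      have h1 : x / 2 + 1 ≤ Real.exp (x / 2) := Real.add_one_le_exp _
      have h2 : Real.exp (-(1 / 2 * x)) = Real.exp (-(1 * x)) * Real.exp (x / 2) := by
        rw [← Real.exp_add]; ring_nf
      rw [h2]
      have := Real.exp_pos (-(1 * x))
      nlinarith
  calc _ ≤ ∫⁻ x, 4 * exponentialPDF (1 / 2) x := lintegral_mono hle
    _ = 4 := by
      rw [lintegral_const_mul' _ _ (by simp), lintegral_exponentialPDF_eq_one (by norm_num), mul_one]

theorem polyaGammaSeries_nonneg (c : ℝ) (g : ℕ → ℝ) : 0 ≤ polyaGammaSeries c g :=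
  ENNReal.toReal_nonneg

theorem measurable_polyaGammaSeries (c : ℝ) : Measurable (polyaGammaSeries c) := by
  unfold polyaGammaSeries
  fun_prop

instance isProbabilityMeasure_polyaGamma (c : ℝ) : IsProbabilityMeasure (polyaGamma c) := by
  have : IsProbabilityMeasure (expMeasure 1) := isProbabilityMeasure_expMeasure one_pos
  exact Measure.isProbabilityMeasure_map (measurable_polyaGammaSeries c).aemeasurable

/-- The mean of the Pólya-Gamma series is bounded uniformly in the tilting parameter. -/
theorem exists_forall_lintegral_polyaGamma_le :
    ∃ M : ℝ, 0 < M ∧ ∀ c, ∫⁻ x, ENNReal.ofReal x ∂(polyaGamma c) ≤ ENNReal.ofReal M := by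
  have : IsProbabilityMeasure (expMeasure 1) := isProbabilityMeasure_expMeasure one_pos
  have hsum : Summable fun k : ℕ => 4 * (((k : ℝ) + 1 / 2) ^ 2)⁻¹ := by
    apply Summable.mul_left
    have h := (summable_nat_add_iff 1).2 (Real.summable_nat_pow_inv.2 (one_lt_two))
    refine Summable.of_nonneg_of_le (fun k => by positivity) (fun k => ?_) (h.mul_left 4)
    rw [← div_eq_mul_inv, le_div_iff₀ (by positivity), inv_mul_le_iff₀ (by positivity)]
    push_cast
    nlinarith [(Nat.cast_nonneg k : (0 : ℝ) ≤ k)]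
  refine ⟨∑' k : ℕ, 4 * (((k : ℝ) + 1 / 2) ^ 2)⁻¹,
    hsum.tsum_pos (fun k => by positivity) 0 (by positivity), fun c => ?_⟩
  rw [polyaGamma, lintegral_map ENNReal.measurable_ofReal (measurable_polyaGammaSeries c),
    ENNReal.ofReal_tsum_of_nonneg (fun k => by positivity) hsum]
  -- Dropping `c² / (4π²) ≥ 0` from the denominators, and using `2π² ≥ 1`, removes the dependence on
  -- `c`.
  calc _ ≤ ∫⁻ g : ℕ → ℝ, ∑' k : ℕ, ENNReal.ofReal (((k : ℝ) + 1 / 2) ^ 2)⁻¹ * ENNReal.ofReal (g k)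
        ∂(Measure.infinitePi fun _ : ℕ => expMeasure 1) := by
        refine lintegral_mono fun g => ENNReal.ofReal_toReal_le.trans ?_
        refine ENNReal.tsum_le_tsum fun k => ?_
        rw [← ENNReal.ofReal_mul (by positivity)]
        rcases le_or_gt (g k) 0 with hg | hg
        · rw [ENNReal.ofReal_of_nonpos (div_nonpos_of_nonpos_of_nonneg hg (by positivity))]
          exact zero_le
        · apply ENNReal.ofReal_le_ofReal
          rw [inv_mul_eq_div]
          apply div_le_div_of_nonneg_left hg.le (by positivity)
          have h1 : 0 ≤ c ^ 2 / (4 * Real.pi ^ 2) := by positivity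
          have h2 : 1 ≤ 2 * Real.pi ^ 2 := by nlinarith [Real.pi_gt_three]
          have h3 : 0 ≤ ((k : ℝ) + 1 / 2) ^ 2 := by positivity
          nlinarith
    _ = ∑' k : ℕ, ENNReal.ofReal (((k : ℝ) + 1 / 2) ^ 2)⁻¹ *
        ∫⁻ x, ENNReal.ofReal x ∂(expMeasure 1) := by
        rw [lintegral_tsum (fun k => ((measurable_pi_apply k).ennreal_ofReal.const_mul _).aemeasurable)]
        refine tsum_congr fun k => ?_
        rw [lintegral_const_mul _ (by fun_prop)]
        congr 1
        exact (measurePreserving_eval_infinitePi (fun _ : ℕ => expMeasure 1) k).lintegral_comp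
          ENNReal.measurable_ofReal
    _ ≤ _ := by
        refine ENNReal.tsum_le_tsum fun k => ?_
        rw [mul_comm, ENNReal.ofReal_mul (by norm_num)]
        gcongr
        simpa using lintegral_ofReal_expMeasure_one_le

/-- The Pólya-Gamma laws are uniformly tight: a fixed interval carries half of the mass. -/
theorem exists_forall_half_le_polyaGamma_Icc :
    ∃ R : ℝ, 0 < R ∧ ∀ c, 2⁻¹ ≤ polyaGamma c (Set.Icc 0 R) := by
  obtain ⟨M, hM, h⟩ := exists_forall_lintegral_polyaGamma_le
  -- Markov's inequality at twice the mean bound leaves at most half of the mass above.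
  refine ⟨2 * M, by positivity, fun c => ?_⟩
  have hneg : polyaGamma c (Set.Iio 0) = 0 := by
    rw [polyaGamma, Measure.map_apply (measurable_polyaGammaSeries c) measurableSet_Iio]
    have hempty : polyaGammaSeries c ⁻¹' Set.Iio 0 = ∅ := by
      ext g
      simpa using polyaGammaSeries_nonneg c g
    rw [hempty, measure_empty]
  have hM0 : ENNReal.ofReal (2 * M) ≠ 0 := by simpa using hM
  have htail : polyaGamma c (Set.Ioi (2 * M)) ≤ 2⁻¹ := by
    calc _ ≤ polyaGamma c {x | ENNReal.ofReal (2 * M) ≤ ENNReal.ofReal x} :=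
          measure_mono fun x hx => ENNReal.ofReal_le_ofReal (le_of_lt hx)
      _ ≤ (∫⁻ x, ENNReal.ofReal x ∂(polyaGamma c)) / ENNReal.ofReal (2 * M) :=
          meas_ge_le_lintegral_div (by fun_prop) hM0 ENNReal.ofReal_ne_top
      _ ≤ ENNReal.ofReal M / ENNReal.ofReal (2 * M) := by gcongr; exact h c
      _ = 2⁻¹ := by
          rw [← ENNReal.ofReal_div_of_pos (by positivity),
            show M / (2 * M) = 2⁻¹ by field_simp, ENNReal.ofReal_inv_of_pos (by norm_num)]
          simp
  have hcompl : polyaGamma c (Set.Icc 0 (2 * M))ᶜ ≤ 2⁻¹ := by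
    calc _ ≤ polyaGamma c (Set.Iio 0 ∪ Set.Ioi (2 * M)) := by
          refine measure_mono fun x hx => ?_
          by_contra hx'
          simp only [Set.mem_union, Set.mem_Iio, Set.mem_Ioi, not_or, not_lt] at hx'
          exact hx hx'
      _ ≤ _ := (measure_union_le _ _).trans (by rw [hneg, zero_add]; exact htail)
  have hadd := prob_add_prob_compl (μ := polyaGamma c) (measurableSet_Icc (a := 0) (b := 2 * M))
  by_contra hlt
  rw [not_le] at hlt
  have : (1 : ℝ≥0∞) < 2⁻¹ + 2⁻¹ := by
    rw [← hadd]
    exact ENNReal.add_lt_add_of_lt_of_le (ne_top_of_le_ne_top (by simp) hcompl) hlt hcompl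
  rw [ENNReal.inv_two_add_inv_two] at this
  exact lt_irrefl _ this

/-! ### Lower bound for the Gaussian update -/

theorem dotProduct_posteriorPrecision_mulVec {n p : ℕ} (X : Matrix (Fin n) (Fin p) ℝ) (ζ : ℝ)
    (ω : Fin n → ℝ) (τ : ℝ) (l u : Fin p → ℝ) :
    u ⬝ᵥ (posteriorPrecision X ζ ω τ l *ᵥ u) =
      ∑ i, ω i * (X *ᵥ u) i ^ 2 + (ζ ^ 2)⁻¹ * ∑ j, u j ^ 2
        + (τ ^ 2)⁻¹ * ∑ j, u j ^ 2 * (l j ^ 2)⁻¹ := by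
  have h1 : u ⬝ᵥ ((Xᵀ * Matrix.diagonal ω * X) *ᵥ u) = ∑ i, ω i * (X *ᵥ u) i ^ 2 := by
    rw [← Matrix.mulVec_mulVec, ← Matrix.mulVec_mulVec, Matrix.dotProduct_mulVec,
      Matrix.vecMul_transpose, dotProduct]
    refine Finset.sum_congr rfl fun i _ => ?_
    rw [Matrix.mulVec_diagonal]
    ring
  rw [posteriorPrecision, Matrix.add_mulVec, Matrix.add_mulVec, dotProduct_add, dotProduct_add, h1,
    Matrix.smul_mulVec, Matrix.smul_mulVec, Matrix.one_mulVec, dotProduct_smul, dotProduct_smul]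
  congr 2
  · simp [dotProduct, sq]
  · simp only [dotProduct, Matrix.mulVec_diagonal]
    exact Finset.sum_congr rfl fun j _ => by ring

theorem isHermitian_posteriorPrecision {n p : ℕ} (X : Matrix (Fin n) (Fin p) ℝ) (ζ : ℝ)
    (ω : Fin n → ℝ) (τ : ℝ) (l : Fin p → ℝ) : (posteriorPrecision X ζ ω τ l).IsHermitian := by
  rw [Matrix.IsHermitian, Matrix.conjTranspose_eq_transpose_of_trivial, posteriorPrecision]
  simp [Matrix.transpose_mul, Matrix.mul_assoc]

theorem le_dotProduct_posteriorPrecision_mulVec {n p : ℕ} (X : Matrix (Fin n) (Fin p) ℝ) (ζ : ℝ)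
    {ω : Fin n → ℝ} (hω : ∀ i, 0 ≤ ω i) (τ : ℝ) (l u : Fin p → ℝ) :
    (ζ ^ 2)⁻¹ * ∑ j, u j ^ 2 ≤ u ⬝ᵥ (posteriorPrecision X ζ ω τ l *ᵥ u) := by
  rw [dotProduct_posteriorPrecision_mulVec]
  have h1 : 0 ≤ ∑ i, ω i * (X *ᵥ u) i ^ 2 :=
    Finset.sum_nonneg fun i _ => mul_nonneg (hω i) (sq_nonneg _)
  have h2 : 0 ≤ (τ ^ 2)⁻¹ * ∑ j, u j ^ 2 * (l j ^ 2)⁻¹ := by positivity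
  linarith

/-- A lower bound for the determinant of a Hermitian matrix from one for its quadratic form. -/
theorem Matrix.IsHermitian.pow_le_det {p : ℕ} {A : Matrix (Fin p) (Fin p) ℝ} (hA : A.IsHermitian)
    {a : ℝ} (ha : 0 ≤ a) (h : ∀ u : Fin p → ℝ, a * ∑ j, u j ^ 2 ≤ u ⬝ᵥ (A *ᵥ u)) :
    a ^ p ≤ A.det := by
  rw [hA.det_eq_prod_eigenvalues]
  calc a ^ p = ∏ _i : Fin p, a := by simp
    _ ≤ _ := by
      refine Finset.prod_le_prod (fun _ _ => ha) fun i _ => ?_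
      -- At a unit eigenvector the quadratic form equals the eigenvalue.
      have h1 := h (hA.eigenvectorBasis i)
      have h2 := hA.eigenvalues_eq i
      have h3 : ∑ j, (hA.eigenvectorBasis i) j ^ 2 = 1 := by
        have := hA.eigenvectorBasis.orthonormal.1 i
        rw [EuclideanSpace.norm_eq, Real.sqrt_eq_one] at this
        simpa using this
      rw [h3, mul_one] at h1
      simpa [h2] using h1

theorem pow_le_det_posteriorPrecision {n p : ℕ} (X : Matrix (Fin n) (Fin p) ℝ) (ζ : ℝ)
    {ω : Fin n → ℝ} (hω : ∀ i, 0 ≤ ω i) (τ : ℝ) (l : Fin p → ℝ) :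
    (ζ ^ 2)⁻¹ ^ p ≤ (posteriorPrecision X ζ ω τ l).det :=
  (isHermitian_posteriorPrecision X ζ ω τ l).pow_le_det (by positivity)
    (le_dotProduct_posteriorPrecision_mulVec X ζ hω τ l)

/-- The linear term `Xᵀ (y - 1/2)` of the log density of the Gaussian update. -/
def posteriorShift {n p : ℕ} (X : Matrix (Fin n) (Fin p) ℝ) (y : Fin n → ℝ) : Fin p → ℝ :=
  Xᵀ *ᵥ fun i => y i - 1 / 2

/-- A lower bound for the density of the Gaussian update which is uniform for `ω ∈ [0, R]ⁿ` and
`τ ≥ τmin`. -/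
def regCoefLowerBound {n p : ℕ} (X : Matrix (Fin n) (Fin p) ℝ) (y : Fin n → ℝ) (ζ R τmin : ℝ)
    (l β : Fin p → ℝ) : ℝ :=
  (Real.sqrt ((2 * Real.pi) ^ p * (ζ ^ 2) ^ p))⁻¹ *
    Real.exp (-(1 / 2) * (R * ∑ i, (X *ᵥ β) i ^ 2 + (ζ ^ 2)⁻¹ * ∑ j, β j ^ 2
      + (τmin ^ 2)⁻¹ * ∑ j, β j ^ 2 * (l j ^ 2)⁻¹ - 2 * (β ⬝ᵥ posteriorShift X y)
      + ζ ^ 2 * ∑ j, posteriorShift X y j ^ 2))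

theorem regCoefLowerBound_pos {n p : ℕ} (X : Matrix (Fin n) (Fin p) ℝ) (y : Fin n → ℝ) {ζ : ℝ}
    (hζ : 0 < ζ) (R τmin : ℝ) (l β : Fin p → ℝ) : 0 < regCoefLowerBound X y ζ R τmin l β := by
  unfold regCoefLowerBound
  positivity

/-- With `v = Xᵀ (y - 1/2)` and `m = Φ⁻¹ v`, the quadratic form in the exponent is `βᵀΦβ - 2 βᵀv +
mᵀv`. The first term grows with `ω` and `τ⁻¹`; `Φ ≥ ζ⁻² I` controls both `mᵀv` and `det Φ⁻¹`. -/
theorem regCoefLowerBound_le {n p : ℕ} (X : Matrix (Fin n) (Fin p) ℝ) (y : Fin n → ℝ) {ζ : ℝ}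
    (hζ : 0 < ζ) {R τmin τ : ℝ} (hτmin : 0 < τmin) (hτ : τmin ≤ τ) {ω : Fin n → ℝ}
    (hω : ∀ i, ω i ∈ Set.Icc 0 R) (l β : Fin p → ℝ) :
    regCoefLowerBound X y ζ R τmin l β ≤ regCoefConditionalDensity X y ζ ω τ l β := by
  have hω0 : ∀ i, 0 ≤ ω i := fun i => (hω i).1
  rw [regCoefLowerBound, regCoefConditionalDensity, gaussianDensity]
  have hfold : (Xᵀ *ᵥ fun i => y i - 1 / 2) = posteriorShift X y := rfl
  rw [hfold]
  have hquad := dotProduct_posteriorPrecision_mulVec X ζ ω τ l β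
  have hlow := le_dotProduct_posteriorPrecision_mulVec X ζ hω0 τ l
  have hdet := pow_le_det_posteriorPrecision X ζ hω0 τ l
  have hsymm : (posteriorPrecision X ζ ω τ l)ᵀ = posteriorPrecision X ζ ω τ l := by
    simpa [Matrix.IsHermitian, Matrix.conjTranspose_eq_transpose_of_trivial] using
      isHermitian_posteriorPrecision X ζ ω τ l
  set Φ := posteriorPrecision X ζ ω τ l with hΦ
  set v := posteriorShift X y with hv
  have hdet0 : 0 < Φ.det := lt_of_lt_of_le (by positivity) hdet
  have hunit : IsUnit Φ.det := hdet0.ne'.isUnit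
  set m := Φ⁻¹ *ᵥ v with hm
  have hΦm : Φ *ᵥ m = v := by
    rw [hm, Matrix.mulVec_mulVec, Matrix.mul_nonsing_inv _ hunit, Matrix.one_mulVec]
  have hmv : m ⬝ᵥ v ≤ ζ ^ 2 * ∑ j, v j ^ 2 := by
    have h1 := hlow m
    rw [hΦm] at h1
    -- Expanding this square and inserting `ζ⁻² |m|² ≤ mᵀΦm = mᵀv` gives the bound without inverting
    -- the order on matrices.
    have h2 : 0 ≤ ∑ j, (ζ⁻¹ * m j - ζ * v j) ^ 2 := by positivity
    have h3 : ∑ j, (ζ⁻¹ * m j - ζ * v j) ^ 2 =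
        (ζ ^ 2)⁻¹ * ∑ j, m j ^ 2 - 2 * (m ⬝ᵥ v) + ζ ^ 2 * ∑ j, v j ^ 2 := by
      simp only [dotProduct, Finset.mul_sum, ← Finset.sum_sub_distrib, ← Finset.sum_add_distrib]
      refine Finset.sum_congr rfl fun j _ => ?_
      field_simp
      ring
    linarith
  have hexp : (β - m) ⬝ᵥ (Φ⁻¹⁻¹ *ᵥ (β - m)) = β ⬝ᵥ (Φ *ᵥ β) - 2 * (β ⬝ᵥ v) + m ⬝ᵥ v := by
    have h1 : m ⬝ᵥ (Φ *ᵥ β) = β ⬝ᵥ v := by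
      rw [Matrix.dotProduct_mulVec, ← Matrix.mulVec_transpose, hsymm, hΦm, dotProduct_comm]
    rw [Matrix.nonsing_inv_nonsing_inv _ hunit, Matrix.mulVec_sub, hΦm, sub_dotProduct,
      dotProduct_sub, dotProduct_sub, h1]
    ring
  have hdetinv : (Φ⁻¹).det ≤ (ζ ^ 2) ^ p := by
    rw [Matrix.det_nonsing_inv, Ring.inverse_eq_inv']
    refine inv_le_of_inv_le₀ (by positivity) ?_
    rwa [← inv_pow]
  have hdetinv0 : 0 < (Φ⁻¹).det := by
    rw [Matrix.det_nonsing_inv, Ring.inverse_eq_inv']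
    positivity
  have hβ : β ⬝ᵥ (Φ *ᵥ β) ≤ R * ∑ i, (X *ᵥ β) i ^ 2 + (ζ ^ 2)⁻¹ * ∑ j, β j ^ 2
      + (τmin ^ 2)⁻¹ * ∑ j, β j ^ 2 * (l j ^ 2)⁻¹ := by
    rw [hquad, Finset.mul_sum _ _ R]
    gcongr with i
    exact (hω i).2
  rw [hexp]
  gcongr ?_ * Real.exp ?_
  · gcongr
  · linarith

theorem ofReal_regCoefLowerBound_le_regCoefKernelDensity {n p : ℕ} (X : Matrix (Fin n) (Fin p) ℝ)
    (y : Fin n → ℝ) {ζ : ℝ} (hζ : 0 < ζ) {R : ℝ}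
    (hR : ∀ c, 2⁻¹ ≤ polyaGamma c (Set.Icc 0 R)) {τmin τ : ℝ} (hτmin : 0 < τmin) (hτ : τmin ≤ τ)
    (βs l β : Fin p → ℝ) :
    2⁻¹ ^ n * ENNReal.ofReal (regCoefLowerBound X y ζ R τmin l β)
      ≤ regCoefKernelDensity X y ζ βs τ l β := by
  have hmass : 2⁻¹ ^ n ≤ polyaGammaConditional X βs (Set.univ.pi fun _ => Set.Icc 0 R) := by
    rw [polyaGammaConditional, Measure.pi_pi]
    calc (2⁻¹ : ℝ≥0∞) ^ n = ∏ _i : Fin n, 2⁻¹ := by simp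
      _ ≤ _ := Finset.prod_le_prod' fun i _ => hR _
  have hbox : MeasurableSet (Set.univ.pi fun _ : Fin n => Set.Icc 0 R) :=
    MeasurableSet.univ_pi fun _ => measurableSet_Icc
  calc _ ≤ ENNReal.ofReal (regCoefLowerBound X y ζ R τmin l β) *
        polyaGammaConditional X βs (Set.univ.pi fun _ => Set.Icc 0 R) := by
        rw [mul_comm]
        gcongr
    _ = ∫⁻ _ in Set.univ.pi fun _ => Set.Icc 0 R,
        ENNReal.ofReal (regCoefLowerBound X y ζ R τmin l β) ∂(polyaGammaConditional X βs) := by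
        rw [setLIntegral_const]
    _ ≤ ∫⁻ ω in Set.univ.pi fun _ => Set.Icc 0 R,
        ENNReal.ofReal (regCoefConditionalDensity X y ζ ω τ l β)
          ∂(polyaGammaConditional X βs) :=
        setLIntegral_mono' hbox fun ω hω => ENNReal.ofReal_le_ofReal
          (regCoefLowerBound_le X y hζ hτmin hτ (fun i => hω i (Set.mem_univ i)) l β)
    _ ≤ _ := setLIntegral_le_lintegral _ _

/-! ### Lower bound for the local scales -/

/-- With `u = |b| / (τ t)`, the inequality `u exp (-u² / 2) ≤ 1` bounds the factor before `πloc` by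
`|b|⁻¹`. Keeping `b` away from `0` thus tames the singularity `t⁻¹` at the origin. -/
theorem localScaleWeight_le {πloc : ℝ → ℝ} (hloc_nonneg : ∀ l, 0 ≤ πloc l) {ε b τ t : ℝ}
    (hε : 0 < ε) (hb : ε ≤ |b|) (hτ : 0 < τ) (ht : 0 < t) :
    localScaleWeight πloc b τ t ≤ ENNReal.ofReal ε⁻¹ * ENNReal.ofReal (πloc t) := by
  rw [localScaleWeight, ← ENNReal.ofReal_mul (by positivity)]
  apply ENNReal.ofReal_le_ofReal
  gcongr
  · exact hloc_nonneg t
  have hx : 0 < (τ * t)⁻¹ := by positivity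
  have hexp : -(b ^ 2) / (2 * τ ^ 2 * t ^ 2) = -((|b| * (τ * t)⁻¹) ^ 2 / 2) := by
    rw [mul_pow, sq_abs]
    field_simp
  rw [hexp, Real.exp_neg, ← div_eq_mul_inv, div_le_iff₀ (Real.exp_pos _), inv_mul_eq_div,
    le_div_iff₀ hε]
  have h1 := Real.add_one_le_exp ((|b| * (τ * t)⁻¹) ^ 2 / 2)
  have h2 : (τ * t)⁻¹ * ε ≤ |b| * (τ * t)⁻¹ := by
    rw [mul_comm]
    gcongr
  -- `u ≤ (1 + u²) / 2 ≤ 1 + u² / 2 ≤ exp (u² / 2)`.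
  nlinarith [sq_nonneg (|b| * (τ * t)⁻¹ - 1)]

/-- A lower bound for the conditional density of a local scale which is uniform for
`ε ≤ |b| ≤ E` and `τmin ≤ τ ≤ τmax`. -/
def localScaleLowerBound (πloc : ℝ → ℝ) (ε E τmin τmax l : ℝ) : ℝ :=
  (τmax * l)⁻¹ * Real.exp (-(E ^ 2) / (2 * τmin ^ 2 * l ^ 2)) * πloc l * ε

theorem ofReal_localScaleLowerBound_le {πloc : ℝ → ℝ} (hloc_nonneg : ∀ l, 0 ≤ πloc l)
    (hloc_pos : ∀ l, l ≤ 0 → πloc l = 0) (hloc_one : ∫⁻ l, ENNReal.ofReal (πloc l) = 1)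
    {ε E b τmin τmax τ : ℝ} (hε : 0 < ε) (hb : ε ≤ |b|) (hbE : |b| ≤ E) (hτmin : 0 < τmin)
    (hτ : τ ∈ Set.Icc τmin τmax) (l : ℝ) :
    ENNReal.ofReal (localScaleLowerBound πloc ε E τmin τmax l)
      ≤ localScaleConditionalDensity πloc b τ l := by
  have hτ0 : 0 < τ := hτmin.trans_le hτ.1
  rcases le_or_gt l 0 with hl | hl
  · simp [localScaleLowerBound, hloc_pos l hl]
  have hZ : ∫⁻ t in Set.Ioi 0, localScaleWeight πloc b τ t ≤ ENNReal.ofReal ε⁻¹ := by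
    calc _ ≤ ∫⁻ t in Set.Ioi 0, ENNReal.ofReal ε⁻¹ * ENNReal.ofReal (πloc t) :=
          setLIntegral_mono' measurableSet_Ioi fun t ht =>
            localScaleWeight_le hloc_nonneg hε hb hτ0 ht
      _ = ENNReal.ofReal ε⁻¹ * ∫⁻ t in Set.Ioi 0, ENNReal.ofReal (πloc t) :=
          lintegral_const_mul' _ _ ENNReal.ofReal_ne_top
      _ ≤ ENNReal.ofReal ε⁻¹ * 1 := by
          gcongr
          exact (setLIntegral_le_lintegral _ _).trans hloc_one.le
      _ = _ := mul_one _
  calc _ ≤ localScaleWeight πloc b τ l * ENNReal.ofReal ε := by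
        rw [localScaleWeight, ← ENNReal.ofReal_mul' hε.le, localScaleLowerBound]
        apply ENNReal.ofReal_le_ofReal
        have h1 : b ^ 2 ≤ E ^ 2 := by
          rw [← sq_abs b]
          gcongr
        have h2 : -(E ^ 2) / (2 * τmin ^ 2 * l ^ 2) ≤ -(b ^ 2) / (2 * τ ^ 2 * l ^ 2) := by
          rw [neg_div, neg_div, neg_le_neg_iff]
          gcongr
          exact hτ.1
        have h3 : τ ≤ τmax := hτ.2
        have h4 := hloc_nonneg l
        gcongr
    _ = localScaleWeight πloc b τ l / ENNReal.ofReal ε⁻¹ := by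
        rw [ENNReal.ofReal_inv_of_pos hε, div_eq_mul_inv, inv_inv]
    _ ≤ _ := ENNReal.div_le_div_left hZ _

/-! ### The law of the global scale -/

theorem measurable_globalScaleWeight {p : ℕ} (β l : Fin p → ℝ) :
    Measurable (globalScaleWeight β l) := by
  unfold globalScaleWeight
  fun_prop

theorem ae_globalScaleConditional_mem_Icc {p : ℕ} {πglo : Measure ℝ} {τmin τmax : ℝ}
    (hglo : πglo (Set.Icc τmin τmax)ᶜ = 0) (βs ls : Fin p → ℝ) :
    ∀ᵐ τ ∂(globalScaleConditional πglo βs ls), τ ∈ Set.Icc τmin τmax := by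
  have h : ∀ᵐ τ ∂πglo, τ ∈ Set.Icc τmin τmax := mem_ae_iff.2 hglo
  exact Measure.ae_smul_measure ((withDensity_absolutelyContinuous _ _).ae_le h) _

/-- On `[τmin, τmax]` the weight is positive and at most `τmin⁻¹ ^ p`, so its normalizing constant
is neither `0` nor `∞`. -/
theorem globalScaleConditional_univ {p : ℕ} (πglo : Measure ℝ) [IsProbabilityMeasure πglo]
    {τmin τmax : ℝ} (hτmin : 0 < τmin) (hglo : πglo (Set.Icc τmin τmax)ᶜ = 0)
    (βs ls : Fin p → ℝ) : globalScaleConditional πglo βs ls Set.univ = 1 := by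
  have hae : ∀ᵐ τ ∂πglo, τ ∈ Set.Icc τmin τmax := mem_ae_iff.2 hglo
  rw [globalScaleConditional, Measure.smul_apply, withDensity_apply _ MeasurableSet.univ,
    Measure.restrict_univ, smul_eq_mul]
  apply ENNReal.inv_mul_cancel
  · rw [Ne, lintegral_eq_zero_iff (measurable_globalScaleWeight βs ls)]
    intro h0
    obtain ⟨τ, h1, h2⟩ := (h0.and hae).exists
    have hτ : 0 < τ := hτmin.trans_le h2.1
    rw [globalScaleWeight, Pi.zero_apply, ENNReal.ofReal_eq_zero] at h1
    exact h1.not_gt (Finset.prod_pos fun j _ => by positivity)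
  · refine ne_top_of_le_ne_top (ENNReal.ofReal_ne_top (r := τmin⁻¹ ^ p)) ?_
    calc _ ≤ ∫⁻ _, ENNReal.ofReal (τmin⁻¹ ^ p) ∂πglo := by
          refine lintegral_mono_ae (hae.mono fun τ hτ => ?_)
          have hτ0 : 0 < τ := hτmin.trans_le hτ.1
          apply ENNReal.ofReal_le_ofReal
          calc _ ≤ ∏ _j : Fin p, τmin⁻¹ := by
                refine Finset.prod_le_prod (fun j _ => by positivity) fun j _ => ?_
                have h1 : Real.exp (-(βs j ^ 2) / (2 * τ ^ 2 * ls j ^ 2)) ≤ 1 := by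
                  rw [Real.exp_le_one_iff]
                  exact div_nonpos_of_nonpos_of_nonneg (by nlinarith [sq_nonneg (βs j)])
                    (by positivity)
                calc _ ≤ τ⁻¹ * 1 := by gcongr
                  _ ≤ τmin⁻¹ := by
                    rw [mul_one]
                    exact inv_anti₀ hτmin hτ.1
            _ = τmin⁻¹ ^ p := by simp
      _ = _ := by simp

/-! ### Assembling the minorization -/

/-- A transition density that dominates, for all starting points in `S`, a measurable function
which is not almost everywhere zero satisfies a minorization condition on `S`. -/
theorem SatisfiesMinorization.of_le {Θ : Type*} [MeasureSpace Θ]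
    [SigmaFinite (volume : Measure Θ)] {P : Θ → Θ → ℝ≥0∞} {S : Set Θ} {f : Θ → ℝ≥0∞}
    (hf : Measurable f) (hf0 : ∫⁻ t, f t ≠ 0) (hle : ∀ s ∈ S, ∀ t, f t ≤ P s t) :
    SatisfiesMinorization P S := by
  -- The integral of `f` is not known to be finite; truncating by a positive integrable `w` makes it
  -- so and keeps the support.
  obtain ⟨w, hw0, hw, hw1⟩ :=
    exists_pos_lintegral_lt_of_sigmaFinite (volume : Measure Θ) one_ne_zero
  have hh : Measurable fun t => min (f t) (w t : ℝ≥0∞) := hf.min hw.coe_nnreal_ennreal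
  set I := ∫⁻ t, min (f t) (w t : ℝ≥0∞) with hI
  have hItop : I ≠ ⊤ :=
    ((lintegral_mono fun t => min_le_right _ _).trans_lt (hw1.trans ENNReal.one_lt_top)).ne
  have hI0 : I ≠ 0 := by
    intro h
    rw [hI, lintegral_eq_zero_iff hh] at h
    refine hf0 ((lintegral_eq_zero_iff hf).2 (h.mono fun t ht => ?_))
    have hwt : (w t : ℝ≥0∞) ≠ 0 := by exact_mod_cast (hw0 t).ne'
    rcases min_choice (f t) (w t : ℝ≥0∞) with h' | h'
    · exact h' ▸ ht
    · exact absurd (h' ▸ ht) hwt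
  refine ⟨I.toReal, ENNReal.toReal_pos hI0 hItop, fun t => I⁻¹ * min (f t) (w t : ℝ≥0∞),
    hh.const_mul _, ?_, fun s hs t => ?_⟩
  · rw [lintegral_const_mul _ hh, ENNReal.inv_mul_cancel hI0 hItop]
  · rw [ENNReal.ofReal_toReal hItop, ← mul_assoc, ENNReal.mul_inv_cancel hI0 hItop, one_mul]
    exact (min_le_left _ _).trans (hle s hs t)

/-- A lower bound for the transition density of the Gibbs sampler which is uniform over the small
set. -/
def gibbsLowerBound {n p : ℕ} (X : Matrix (Fin n) (Fin p) ℝ) (y : Fin n → ℝ) (ζ : ℝ)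
    (πloc : ℝ → ℝ) (R τmin τmax ε E : ℝ) (t : (Fin p → ℝ) × (Fin p → ℝ)) : ℝ≥0∞ :=
  2⁻¹ ^ n * ENNReal.ofReal (regCoefLowerBound X y ζ R τmin t.2 t.1) *
    ∏ j, ENNReal.ofReal (localScaleLowerBound πloc ε E τmin τmax (t.2 j))

theorem measurable_gibbsLowerBound {n p : ℕ} (X : Matrix (Fin n) (Fin p) ℝ) (y : Fin n → ℝ)
    (ζ : ℝ) {πloc : ℝ → ℝ} (hloc_meas : Measurable πloc) (R τmin τmax ε E : ℝ) :
    Measurable (gibbsLowerBound X y ζ πloc R τmin τmax ε E) := by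
  unfold gibbsLowerBound regCoefLowerBound localScaleLowerBound Matrix.mulVec dotProduct
  fun_prop

theorem lintegral_gibbsLowerBound_ne_zero {n p : ℕ} (X : Matrix (Fin n) (Fin p) ℝ)
    (y : Fin n → ℝ) {ζ : ℝ} (hζ : 0 < ζ) {πloc : ℝ → ℝ} (hloc_meas : Measurable πloc)
    (hloc_pos : ∀ l, l ≤ 0 → πloc l = 0) (hloc_one : ∫⁻ l, ENNReal.ofReal (πloc l) = 1)
    (R τmin : ℝ) {τmax ε : ℝ} (hτmax : 0 < τmax) (hε : 0 < ε) (E : ℝ) :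
    ∫⁻ t, gibbsLowerBound (p := p) X y ζ πloc R τmin τmax ε E t ≠ 0 := by
  rw [Ne, lintegral_eq_zero_iff (measurable_gibbsLowerBound X y ζ hloc_meas R τmin τmax ε E)]
  intro h
  have hpos : ∀ t ∈ (Set.univ : Set (Fin p → ℝ)) ×ˢ Set.univ.pi fun _ : Fin p => {l | 0 < πloc l},
      gibbsLowerBound X y ζ πloc R τmin τmax ε E t ≠ 0 := by
    rintro ⟨β, l⟩ ⟨-, hl⟩
    refine mul_ne_zero (mul_ne_zero (pow_ne_zero _ (by simp)) ?_) (Finset.prod_ne_zero_iff.2 ?_)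
    · exact (ENNReal.ofReal_pos.2 (regCoefLowerBound_pos X y hζ R τmin l β)).ne'
    · intro j _
      have hj : 0 < πloc (l j) := hl j (Set.mem_univ j)
      have hlj : 0 < l j := by
        by_contra hneg
        rw [hloc_pos _ (not_lt.1 hneg)] at hj
        exact lt_irrefl _ hj
      refine (ENNReal.ofReal_pos.2 ?_).ne'
      dsimp only
      unfold localScaleLowerBound
      positivity
  have hzero := measure_mono_null (fun t ht => hpos t ht) (ae_iff.1 h)
  rw [Measure.volume_eq_prod, Measure.prod_prod, volume_pi, Measure.pi_pi,
    Finset.prod_const] at hzero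
  have hloc0 : volume {l | 0 < πloc l} ≠ 0 := by
    intro h0
    have hnot : ∀ᵐ l, ¬ 0 < πloc l := ae_iff.2 (by simpa only [not_not] using h0)
    have hae : ∀ᵐ l, ENNReal.ofReal (πloc l) = 0 :=
      hnot.mono fun l hl => ENNReal.ofReal_of_nonpos (not_lt.1 hl)
    rw [lintegral_congr_ae hae, lintegral_zero] at hloc_one
    exact zero_ne_one hloc_one
  rcases mul_eq_zero.1 hzero with h0 | h0
  -- As a box, the whole space has for volume a product of infinite factors, which is nonzero even
  -- when empty (`p = 0`).
  · rw [← Set.pi_univ Set.univ, Measure.pi_pi] at h0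
    simp at h0
  · exact hloc0 (eq_zero_of_pow_eq_zero h0)

end

theorem mainTheorem7 {n p : ℕ} (X : Matrix (Fin n) (Fin p) ℝ) (y : Fin n → ℝ)
    (hy : ∀ i, y i = 0 ∨ y i = 1) (ζ : ℝ) (hζ : 0 < ζ)
    (πloc : ℝ → ℝ) (hloc_meas : Measurable πloc) (hloc_nonneg : ∀ l, 0 ≤ πloc l)
    (hloc_pos : ∀ l, l ≤ 0 → πloc l = 0) (hloc_one : ∫⁻ l, ENNReal.ofReal (πloc l) = 1)
    (πglo : Measure ℝ) [IsProbabilityMeasure πglo]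
    (τmin τmax : ℝ) (hτmin : 0 < τmin) (hτ : τmin ≤ τmax)
    (hglo : πglo (Set.Icc τmin τmax)ᶜ = 0)
    (ε E : ℝ) (hε : 0 < ε) (hE : ε ≤ E) :
    SatisfiesMinorization (gibbsKernelDensity X y ζ πloc πglo)
      {s : (Fin p → ℝ) × (Fin p → ℝ) |
        (∀ j, 0 < s.2 j) ∧ ∀ j, ε ≤ |s.1 j| ∧ |s.1 j| ≤ E} := by
  obtain ⟨R, -, hR⟩ := exists_forall_half_le_polyaGamma_Icc
  refine SatisfiesMinorization.of_le
    (measurable_gibbsLowerBound X y ζ hloc_meas R τmin τmax ε E)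
    (lintegral_gibbsLowerBound_ne_zero X y hζ hloc_meas hloc_pos hloc_one R τmin
      (hτmin.trans_le hτ) hε E) ?_
  rintro ⟨βs, ls⟩ ⟨-, hβs⟩ ⟨β, l⟩
  -- The bound is constant in `τ`, hence equal to its average under the law of `τ`.
  calc _ = ∫⁻ _, gibbsLowerBound X y ζ πloc R τmin τmax ε E (β, l)
        ∂(globalScaleConditional πglo βs ls) := by
        rw [lintegral_const, globalScaleConditional_univ πglo hτmin hglo, mul_one]
    _ ≤ _ := by
        refine lintegral_mono_ae ((ae_globalScaleConditional_mem_Icc hglo βs ls).mono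
          fun τ hτ' => mul_le_mul' ?_ (Finset.prod_le_prod' fun j _ => ?_))
        · exact ofReal_regCoefLowerBound_le_regCoefKernelDensity X y hζ hR hτmin hτ'.1 βs l β
        · exact ofReal_localScaleLowerBound_le hloc_nonneg hloc_pos hloc_one hε (hβs j).1
            (hβs j).2 hτmin hτ' (l j)
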